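/- Let $1\le m\le n$ be integers, let $|\psi\rangle=\sum_{s\in\{0,1\}^n}\Psi(s)|s\rangle$ be a normalized $n$-qubit pure state, and let $\rho$ be any $n$-qubit density matrix. For a set $k$ of $m$ qubits, $z\in\{0,1\}^{n-m}$ (a bit string on the qubits outside $k$) and $\ell\in\{0,1\}^m$ (a bit string on $k$), let $z^{\ell}\in\{0,1\}^n$ be the string that equals $\ell$ on $k$ and $z$ outside $k$, and put $$|\Psi_{z}\rangle=\frac{\sum_{\ell\in\{0,1\}^m}\Psi(z^\ell)|\ell\rangle}{\sqrt{\sum_{\ell\in\{0,1\}^m}|\Psi(z^\ell)|^2}},\qquad L_{z}=|\Psi_{z}\rangle\langle\Psi_{z}|,$$ with $|\Psi_z\rangle=0$ if $\Psi(z^\ell)=0$ for all $\ell$. (The vector $|\Psi_z\rangle$ and the operator $L_z$ depend on $k$ as well as on $z$.) Let $$L=\binom nm^{-1}\sum_{k}\ \sum_{z\in\{0,1\}^{n-m}}|z\rangle\langle z|\otimes L_{z},$$ where $k$ ranges over all sets of $m$ of the $n$ qubits and $L_z$ acts on the qubits in $k$. Consider the following random experiment on $\rho$. Choose a set $k$ of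 $m$ qubits uniformly at random. Measure all the other qubits in the computational basis, with outcome $z$; outcome $z$ has probability $\mathrm{tr}\langle z|\rho|z\rangle$ and leaves the qubits in $k$ in the state $\rho_z=\langle z|\rho|z\rangle/\mathrm{tr}\langle z|\rho|z\rangle$. Choose $U$ uniformly at random from the $m$-qubit Clifford group (the normalizer of the $m$-qubit Pauli group in the unitary group, modulo global phases), apply it to the qubits in $k$, and measure these in the computational basis, with outcome $b\in\{0,1\}^m$; outcome $b$ has probability $\langle b|U\rho_zU^\dagger|b\rangle$. Let $$\sigma=(2^m+1)\,U^\dagger|b\rangle\langle b|U-\mathbb I,\qquad \omega=\mathrm{tr}(L_{z}\sigma).$$ Then $$\mathrm{tr}(L\rho)=\mathbb E[\omega].$$ -/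

import Mathlib

open scoped Kronecker ComplexOrder

set_option linter.unusedSectionVars false

noncomputable section

namespace ShadowOverlap

/-- Bit strings indexed by a set `κ` of qubits; they label the computational basis. -/
abbrev Bits (κ : Type) : Type := κ → ZMod 2

section Clifford

variable {κ : Type} [Fintype κ] [DecidableEq κ]

/-- The sign `(-1)^(z · t)`. -/
def sgn (z t : Bits κ) : ℂ := ∏ j, (-1 : ℂ) ^ ((z j).val * (t j).val)

theorem sgn_add_right (z t u : Bits κ) : sgn z (t + u) = sgn z t * sgn z u := by
  have key : ∀ a b c : ZMod 2,
      (-1 : ℤ) ^ (a.val * (b + c).val) = (-1) ^ (a.val * b.val) * (-1) ^ (a.val * c.val) := by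
    decide
  unfold sgn
  rw [← Finset.prod_mul_distrib]
  refine Finset.prod_congr rfl fun j _ => ?_
  exact_mod_cast congrArg (fun x : ℤ => (x : ℂ)) (key (z j) (t j) (u j))

theorem sgn_comm (z t : Bits κ) : sgn z t = sgn t z := by
  unfold sgn
  exact Finset.prod_congr rfl fun j _ => by rw [mul_comm]

theorem sgn_add_left (z w t : Bits κ) : sgn (z + w) t = sgn z t * sgn w t := by
  rw [sgn_comm, sgn_add_right, sgn_comm t z, sgn_comm t w]

theorem sgn_zero_left (t : Bits κ) : sgn 0 t = 1 := by simp [sgn]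

theorem sgn_eq (z t : Bits κ) : sgn z t = 1 ∨ sgn z t = -1 := by
  unfold sgn
  refine Finset.prod_induction _ (fun c : ℂ => c = 1 ∨ c = -1) ?_ (Or.inl rfl) ?_
  · rintro a b (rfl | rfl) (rfl | rfl) <;> simp
  · intro j _
    exact neg_one_pow_eq_or ℂ _

theorem sgn_sq (z t : Bits κ) : sgn z t * sgn z t = 1 := by
  rcases sgn_eq z t with h | h <;> simp [h]

theorem bits_add_self (x : Bits κ) : x + x = 0 := by
  funext j
  exact (by decide : ∀ a : ZMod 2, a + a = 0) (x j)

theorem bits_eq_add_iff (s t x : Bits κ) : s = t + x ↔ t = s + x := by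
  constructor <;> · rintro rfl; rw [add_assoc, bits_add_self, add_zero]

/-- The Pauli string `X^x Z^z = ⨂_j X^{x_j} Z^{z_j}`, which maps the basis vector `|t⟩` to
`(-1)^(z · t) |t + x⟩`. -/
def pauliString (x z : Bits κ) : Matrix (Bits κ) (Bits κ) ℂ :=
  Matrix.of fun s t => if s = t + x then sgn z t else 0

theorem pauliString_apply (x z s t : Bits κ) :
    pauliString x z s t = if s = t + x then sgn z t else 0 := rfl

theorem pauliString_zero : pauliString (0 : Bits κ) 0 = 1 := by
  ext s t
  simp [pauliString_apply, Matrix.one_apply, sgn_zero_left]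

theorem pauliString_mul (x z y w : Bits κ) :
    pauliString x z * pauliString y w = sgn z y • pauliString (x + y) (z + w) := by
  ext s t
  simp only [Matrix.mul_apply, Matrix.smul_apply, pauliString_apply, smul_eq_mul]
  rw [Finset.sum_eq_single (t + y)]
  · have : t + (x + y) = t + y + x := by abel
    rw [this]
    by_cases h : s = t + y + x
    · simp only [h, if_true, sgn_add_left, sgn_add_right]; ring
    · simp [h]
  · intro b _ hb
    simp [hb]
  · simp

theorem pauliString_star (x z : Bits κ) :
    star (pauliString x z) = sgn z x • pauliString x z := by
  ext s t
  simp only [Matrix.star_apply, Matrix.smul_apply, pauliString_apply, smul_eq_mul]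
  by_cases h : s = t + x
  · have h' : t = s + x := (bits_eq_add_iff s t x).1 h
    rw [if_pos h', if_pos h, h, sgn_add_right]
    rcases sgn_eq z t with h1 | h1 <;> rcases sgn_eq z x with h2 | h2 <;> simp [h1, h2]
  · have h' : ¬ t = s + x := fun h' => h ((bits_eq_add_iff s t x).2 h')
    simp [h, h']

theorem sgn_eq_I_pow (z t : Bits κ) : ∃ a : ℕ, sgn z t = Complex.I ^ a := by
  rcases sgn_eq z t with h | h
  · exact ⟨0, by simp [h]⟩
  · exact ⟨2, by simp [h]⟩

variable (κ) in
/-- The Pauli group on the qubits `κ`: all `i^a X^x Z^z`, that is, all tensor products of the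
matrices `I`, `X`, `Y = i X Z`, `Z`, with global phases `±1, ±i`. -/
def pauliGroup : Subgroup (Matrix.unitaryGroup (Bits κ) ℂ) where
  carrier := {U | ∃ (a : ℕ) (x z : Bits κ),
    (U : Matrix (Bits κ) (Bits κ) ℂ) = Complex.I ^ a • pauliString x z}
  one_mem' := ⟨0, 0, 0, by simp [pauliString_zero]⟩
  mul_mem' := by
    rintro U V ⟨a, x, z, hU⟩ ⟨b, y, w, hV⟩
    obtain ⟨c, hc⟩ := sgn_eq_I_pow z y
    refine ⟨a + b + c, x + y, z + w, ?_⟩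
    rw [Submonoid.coe_mul, hU, hV, smul_mul_smul_comm, pauliString_mul, smul_smul, hc, pow_add,
      pow_add]
  inv_mem' := by
    rintro U ⟨a, x, z, hU⟩
    obtain ⟨c, hc⟩ := sgn_eq_I_pow z x
    refine ⟨3 * a + c, x, z, ?_⟩
    have : ((U⁻¹ : Matrix.unitaryGroup (Bits κ) ℂ) : Matrix (Bits κ) (Bits κ) ℂ)
        = star (U : Matrix (Bits κ) (Bits κ) ℂ) := rfl
    rw [this, hU, star_smul, pauliString_star, smul_smul, hc, pow_add, pow_mul]
    simp

variable (κ) in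
/-- The Clifford group on the qubits `κ`: the normalizer of the Pauli group in the unitary
group. It contains all global phases `c • 1` with `|c| = 1`. -/
abbrev cliffordGroup : Subgroup (Matrix.unitaryGroup (Bits κ) ℂ) :=
  Subgroup.normalizer (pauliGroup κ : Set (Matrix.unitaryGroup (Bits κ) ℂ))

variable (κ) in
/-- The global phases, as a subgroup of the Clifford group. -/
def globalPhases : Subgroup (cliffordGroup κ) where
  carrier := {U | ∃ c : ℂ, (U.1.1 : Matrix (Bits κ) (Bits κ) ℂ) = c • 1}
  one_mem' := ⟨1, by simp⟩
  mul_mem' := by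
    rintro U V ⟨c, hc⟩ ⟨d, hd⟩
    refine ⟨c * d, ?_⟩
    have : ((U * V).1.1 : Matrix (Bits κ) (Bits κ) ℂ) = U.1.1 * V.1.1 := rfl
    rw [this, hc, hd, smul_mul_smul_comm, one_mul]
  inv_mem' := by
    rintro U ⟨c, hc⟩
    refine ⟨star c, ?_⟩
    have : ((U⁻¹).1.1 : Matrix (Bits κ) (Bits κ) ℂ) = star U.1.1 := rfl
    rw [this, hc, star_smul, star_one]

instance : (globalPhases κ).Normal where
  conj_mem := by
    rintro U ⟨c, hc⟩ V
    refine ⟨c, ?_⟩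
    have h1 : ((V * U * V⁻¹).1.1 : Matrix (Bits κ) (Bits κ) ℂ)
        = V.1.1 * U.1.1 * (V⁻¹).1.1 := rfl
    have h2 : (V.1.1 * (V⁻¹).1.1 : Matrix (Bits κ) (Bits κ) ℂ) = 1 := by
      have : (V.1.1 * (V⁻¹).1.1 : Matrix (Bits κ) (Bits κ) ℂ) = (V * V⁻¹).1.1 := rfl
      rw [this, mul_inv_cancel]; rfl
    rw [h1, hc, mul_smul_comm, mul_one, smul_mul_assoc, h2]

variable (κ) in
/-- The finite Clifford group `Cl(2^m)` on `m = |κ|` qubits: Clifford unitaries up to a global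
phase. -/
abbrev Cl : Type := cliffordGroup κ ⧸ globalPhases κ

theorem pauliString_mem_unitary (x z : Bits κ) :
    pauliString x z ∈ Matrix.unitaryGroup (Bits κ) ℂ := by
  rw [Matrix.mem_unitaryGroup_iff, pauliString_star, mul_smul_comm, pauliString_mul, smul_smul,
    sgn_sq, bits_add_self, bits_add_self, pauliString_zero, one_smul]

instance : Finite (pauliGroup κ) := by
  let f : Fin 4 × Bits κ × Bits κ → Matrix (Bits κ) (Bits κ) ℂ :=
    fun p => Complex.I ^ (p.1 : ℕ) • pauliString p.2.1 p.2.2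
  have hf : (Set.range f).Finite := Set.finite_range f
  have := hf.to_subtype
  refine Finite.of_injective
    (fun U : pauliGroup κ => (⟨U.1.1, ?_⟩ : Set.range f)) ?_
  · obtain ⟨a, x, z, h⟩ := U.2
    refine ⟨(⟨a % 4, Nat.mod_lt _ (by norm_num)⟩, x, z), ?_⟩
    simp only [f]
    rw [h, ← Complex.I_pow_eq_pow_mod]
  · intro U V h
    exact Subtype.ext (Subtype.ext (congrArg (fun A : Set.range f => A.1) h))

theorem eq_smul_one_of_commute (M : Matrix (Bits κ) (Bits κ) ℂ)
    (h : ∀ x z, M * pauliString x z = pauliString x z * M) : ∃ c : ℂ, M = c • 1 := by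
  have hX : ∀ x s t, M s (t + x) = M (s + x) t := by
    intro x s t
    have := congrFun (congrFun (h x 0) s) t
    simp only [Matrix.mul_apply, pauliString_apply, sgn_zero_left, mul_ite, mul_one, mul_zero,
      ite_mul, one_mul, zero_mul, bits_eq_add_iff s _ x] at this
    simpa using this
  have hZ : ∀ z s t, M s t * sgn z t = sgn z s * M s t := by
    intro z s t
    have := congrFun (congrFun (h 0 z) s) t
    simpa [Matrix.mul_apply, pauliString_apply] using this
  refine ⟨M 0 0, ?_⟩
  ext s t
  by_cases hst : s = t
  · subst hst
    have := hX s 0 s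
    rw [bits_add_self, zero_add] at this
    simp [this]
  · obtain ⟨j, hj⟩ := Function.ne_iff.1 hst
    have hs : ∀ u : Bits κ, sgn (Pi.single j 1) u = (-1 : ℂ) ^ (u j).val := by
      intro u
      unfold sgn
      rw [Finset.prod_eq_single j]
      · simp [ZMod.val_one]
      · intro i _ hi
        simp [Pi.single_eq_of_ne hi]
      · simp
    have h1 := hZ (Pi.single j 1) s t
    rw [hs, hs] at h1
    have key : ∀ a b : ZMod 2, a ≠ b → (-1 : ℤ) ^ b.val = -(-1) ^ a.val := by decide
    have h2 : (-1 : ℂ) ^ (t j).val = -(-1) ^ (s j).val := by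
      exact_mod_cast congrArg (fun x : ℤ => (x : ℂ)) (key (s j) (t j) hj)
    rw [h2] at h1
    have h3 : (-1 : ℂ) ^ (s j).val ≠ 0 := pow_ne_zero _ (by norm_num)
    have h4 : (-1 : ℂ) ^ (s j).val * M s t = 0 := by linear_combination (-1 / 2 : ℂ) * h1
    have h5 : M s t = 0 := (mul_eq_zero.1 h4).resolve_left h3
    simp [h5, hst]

instance : Finite (Cl κ) := by
  have hle : (Subgroup.normalizerMonoidHom (pauliGroup κ)).ker ≤ globalPhases κ := by
    intro U hU
    refine eq_smul_one_of_commute U.1.1 fun x z => ?_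
    let P : pauliGroup κ :=
      ⟨⟨pauliString x z, pauliString_mem_unitary x z⟩, ⟨0, x, z, by simp⟩⟩
    have h1 : U.1 * P.1 * U.1⁻¹ = P.1 :=
      congrArg Subtype.val (DFunLike.congr_fun (MonoidHom.mem_ker.1 hU) P)
    have h2 : U.1 * P.1 = P.1 * U.1 := mul_inv_eq_iff_eq_mul.1 h1
    exact congrArg Subtype.val h2
  have : Finite (MulAut (pauliGroup κ)) := Finite.of_injective _ DFunLike.coe_injective
  have : (Subgroup.normalizerMonoidHom (pauliGroup κ)).ker.FiniteIndex := inferInstance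
  have : (globalPhases κ).FiniteIndex := Subgroup.finiteIndex_of_le hle
  infer_instance

instance : Fintype (Cl κ) := Fintype.ofFinite _

/-- A Clifford unitary representing an element of the Clifford group modulo global phases. A
different choice of the global phase changes neither `U ρ Uᴴ` nor `Uᴴ |b⟩⟨b| U`. -/
def Cl.unitary (g : Cl κ) : Matrix (Bits κ) (Bits κ) ℂ := (Quotient.out g).1.1

theorem Cl.unitary_mem (g : Cl κ) : g.unitary ∈ Matrix.unitaryGroup (Bits κ) ℂ :=
  (Quotient.out g).1.2

/-- The classical shadow `(2^m + 1) Uᴴ |b⟩⟨b| U - 1` on `m = |κ|` qubits. -/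
def cliffordShadow (U : Matrix (Bits κ) (Bits κ) ℂ) (b : Bits κ) :
    Matrix (Bits κ) (Bits κ) ℂ :=
  ((2 : ℂ) ^ Fintype.card κ + 1) • (U.conjTranspose * Matrix.single b b 1 * U) - 1

end Clifford

section States

variable {κ : Type} [Fintype κ] [DecidableEq κ]

variable (κ) in
/-- A (mixed) quantum state of the qubits `κ`, given by its density matrix. -/
structure QState where
  /-- the density matrix -/
  mat : Matrix (Bits κ) (Bits κ) ℂ
  posSemidef : mat.PosSemidef
  trace_eq_one : mat.trace = 1

/-- Nonnegative complex weights of total `1` give real weights of total `1`. -/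
theorem sum_ofReal_re_eq_one {α : Type} [Fintype α] (w : α → ℂ) (h0 : ∀ a, 0 ≤ w a)
    (h1 : ∑ a, w a = 1) : ∑ a, ENNReal.ofReal (w a).re = 1 := by
  rw [← ENNReal.ofReal_sum_of_nonneg fun a _ => (Complex.nonneg_iff.1 (h0 a)).1,
    ← Complex.re_sum, h1]
  simp

/-- The outcome distribution of a computational basis measurement of all qubits: the outcome `b`
has probability `⟨b|ρ|b⟩`. -/
def QState.measure (ρ : QState κ) : PMF (Bits κ) :=
  PMF.ofFintype (fun b => ENNReal.ofReal (ρ.mat b b).re)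
    (sum_ofReal_re_eq_one _ (fun _ => ρ.posSemidef.diag_nonneg) ρ.trace_eq_one)

/-- The state `U ρ Uᴴ`. -/
def QState.evolve (ρ : QState κ) (U : Matrix (Bits κ) (Bits κ) ℂ)
    (hU : U ∈ Matrix.unitaryGroup (Bits κ) ℂ) : QState κ where
  mat := U * ρ.mat * U.conjTranspose
  posSemidef := ρ.posSemidef.mul_mul_conjTranspose_same U
  trace_eq_one := by
    have h : U.conjTranspose * U = 1 := Matrix.mem_unitaryGroup_iff'.1 hU
    rw [Matrix.trace_mul_cycle, h, one_mul, ρ.trace_eq_one]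

/-- Bit strings on the qubits outside `k` together with bit strings on `k`, identified with bit
strings on all qubits: `joinBits k (z, ℓ)` equals `ℓ` on `k` and `z` outside `k`. -/
def joinBits (k : Finset κ) : Bits {j // j ∉ k} × Bits {j // j ∈ k} ≃ Bits κ :=
  (Equiv.prodComm _ _).trans (Equiv.piEquivPiSubtypeProd (· ∈ k) fun _ => ZMod 2).symm

theorem joinBits_apply_mem (k : Finset κ) (z : Bits {j // j ∉ k}) (l : Bits {j // j ∈ k})
    {j : κ} (h : j ∈ k) : joinBits k (z, l) j = l ⟨j, h⟩ := by
  simp [joinBits, h]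

theorem joinBits_apply_notMem (k : Finset κ) (z : Bits {j // j ∉ k}) (l : Bits {j // j ∈ k})
    {j : κ} (h : j ∉ k) : joinBits k (z, l) j = z ⟨j, h⟩ := by
  simp [joinBits, h]

/-- The operator `⟨z|ρ|z⟩` on the qubits in `k`, for `z` a bit string on the other qubits. -/
def QState.block (ρ : QState κ) (k : Finset κ) (z : Bits {j // j ∉ k}) :
    Matrix (Bits {j // j ∈ k}) (Bits {j // j ∈ k}) ℂ :=
  ρ.mat.submatrix (fun l => joinBits k (z, l)) (fun l => joinBits k (z, l))

theorem QState.block_posSemidef (ρ : QState κ) (k : Finset κ) (z : Bits {j // j ∉ k}) :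
    (ρ.block k z).PosSemidef :=
  ρ.posSemidef.submatrix _

theorem QState.sum_trace_block (ρ : QState κ) (k : Finset κ) :
    ∑ z, (ρ.block k z).trace = 1 := by
  rw [← ρ.trace_eq_one]
  simp only [Matrix.trace, Matrix.diag_apply, QState.block, Matrix.submatrix_apply]
  rw [← Fintype.sum_prod_type', ← Equiv.sum_comp (joinBits k)]

/-- The outcome distribution of a computational (`Z`) basis measurement of all qubits outside
`k`: the outcome `z` has probability `tr ⟨z|ρ|z⟩`. -/
def QState.measureOutside (ρ : QState κ) (k : Finset κ) : PMF (Bits {j // j ∉ k}) :=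
  PMF.ofFintype (fun z => ENNReal.ofReal (ρ.block k z).trace.re)
    (sum_ofReal_re_eq_one _ (fun z => (ρ.block_posSemidef k z).trace_nonneg)
      (ρ.sum_trace_block k))

/-- The post-measurement state `⟨z|ρ|z⟩ / tr ⟨z|ρ|z⟩` of the qubits in `k`, for an outcome `z`
of positive probability. -/
def QState.postState (ρ : QState κ) (k : Finset κ) (z : Bits {j // j ∉ k})
    (hz : z ∈ (ρ.measureOutside k).support) : QState {j // j ∈ k} where
  mat := (ρ.block k z).trace⁻¹ • ρ.block k z
  posSemidef := (ρ.block_posSemidef k z).smul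
    (inv_nonneg.2 (ρ.block_posSemidef k z).trace_nonneg)
  trace_eq_one := by
    have h : (ρ.block k z).trace ≠ 0 := by
      intro h
      apply (PMF.mem_support_iff _ _).1 hz
      simp [QState.measureOutside, h]
    rw [Matrix.trace_smul, smul_eq_mul, inv_mul_cancel₀ h]

end States

section Protocol

variable {n : ℕ}

/-- The hypothesis vector `|Ψ_z⟩ = ∑_ℓ Ψ(z^ℓ) |ℓ⟩ / √(∑_ℓ |Ψ(z^ℓ)|²)` on the qubits in `k`, for
`z` a bit string on the other qubits; it is `0` if all the amplitudes `Ψ(z^ℓ)` vanish. -/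
def hypVec (Ψ : Bits (Fin n) → ℂ) (k : Finset (Fin n)) (z : Bits {j // j ∉ k}) :
    Bits {j // j ∈ k} → ℂ :=
  fun l => Ψ (joinBits k (z, l)) / (Real.sqrt (∑ l', ‖Ψ (joinBits k (z, l'))‖ ^ 2) : ℂ)

/-- The observable `L_z = |Ψ_z⟩⟨Ψ_z|` on the qubits in `k`. -/
def localObs (Ψ : Bits (Fin n) → ℂ) (k : Finset (Fin n)) (z : Bits {j // j ∉ k}) :
    Matrix (Bits {j // j ∈ k}) (Bits {j // j ∈ k}) ℂ :=
  Matrix.vecMulVec (hypVec Ψ k z) (star (hypVec Ψ k z))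

/-- The operator `L = (n choose m)⁻¹ ∑_k ∑_z |z⟩⟨z| ⊗ L_z`, with `k` running over the sets of
`m` qubits and `z` over the bit strings on the qubits outside `k`. -/
def shadowOp (Ψ : Bits (Fin n) → ℂ) (m : ℕ) : Matrix (Bits (Fin n)) (Bits (Fin n)) ℂ :=
  (n.choose m : ℂ)⁻¹ • ∑ k ∈ Finset.powersetCard m (Finset.univ : Finset (Fin n)),
    ∑ z : Bits {j // j ∉ k},
      Matrix.reindex (joinBits k) (joinBits k) (Matrix.single z z 1 ⊗ₖ localObs Ψ k z)

/-- The record of one round of the protocol: the set `k` of qubits, the outcome `z` on the other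
qubits, the Clifford circuit, and the outcome `b` on the qubits in `k`. -/
def Transcript (n : ℕ) : Type :=
  Σ k : Finset (Fin n), Bits {j // j ∉ k} × Cl {j // j ∈ k} × Bits {j // j ∈ k}

instance : Finite (Transcript n) := by unfold Transcript; infer_instance

instance : MeasurableSpace (Transcript n) := ⊤

instance : DiscreteMeasurableSpace (Transcript n) := ⟨fun _ => trivial⟩

/-- One round of the level-`m` protocol with random Cliffords on the state `ρ`: choose a uniformly
random set `k` of `m` qubits, measure the other qubits in the computational basis, apply a
uniformly random Clifford circuit to the qubits in `k` and measure them in the computational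
basis. -/
def protocol (ρ : QState (Fin n)) (m : ℕ) (hm : m ≤ n) : PMF (Transcript n) :=
  (PMF.uniformOfFinset (Finset.powersetCard m (Finset.univ : Finset (Fin n)))
      (Finset.powersetCard_nonempty.2 (by simpa using hm))).bind fun k =>
    (ρ.measureOutside k).bindOnSupport fun z hz =>
      (PMF.uniformOfFintype (Cl {j // j ∈ k})).bind fun g =>
        ((ρ.postState k z hz).evolve g.unitary g.unitary_mem).measure.map fun b =>
          (⟨k, z, g, b⟩ : Transcript n)

/-- The overlap `ω = tr (L_z σ)`, with `σ` the Clifford classical shadow. -/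
def overlap (Ψ : Bits (Fin n) → ℂ) : Transcript n → ℂ :=
  fun ⟨k, z, g, b⟩ => (localObs Ψ k z * cliffordShadow g.unitary b).trace

end Protocol

end ShadowOverlap

end

/-! Fix `k` and `z`. If the shadow `σ` has conditional mean `ρ_z`, then `ω` has conditional mean `tr
(L_z ρ_z)`. Weighting by the outcome probabilities cancels the normalization of `ρ_z` and leaves the
sum of `tr (L_z ⟨z|ρ|z⟩)`, which is the contribution of `k` to `tr (L ρ)` (`trace_shadowOp_mul`).

Unbiasedness of `σ` (`sum_cliffordShadow`) inverts the measurement channel computed in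
`clifford_measurement_channel`. Let `D = 2^m`, let `N` be the number of Cliffords modulo phases, and
let `G P` be the sum over Cliffords `U` of the conjugations of `A` by `Uᴴ P U`. Dephasing is an
average over `Z`-strings, so `D` times the unnormalized channel is the sum of `G` over the
`Z`-strings. Here `G 1 = N A`. All other `G P` agree, because Cliffords permute the nontrivial Pauli
strings transitively up to phase (`exists_clifford_conj_eq`). The full Pauli twirl gives the sum of
all `G P` as `N D tr(A) 1`. These facts determine the channel, so no general 2-design theory is
needed. -/

namespace ShadowOverlap

/-! ### Pauli twirls and transitivity of the Clifford action on Pauli strings -/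

section Pauli

variable {κ : Type} [Fintype κ] [DecidableEq κ]

theorem sgn_zero_right (z : Bits κ) : sgn z 0 = 1 := by simp [sgn]

theorem star_sgn (z t : Bits κ) : star (sgn z t) = sgn z t := by
  rcases sgn_eq z t with h | h <;> simp [h]

theorem exists_sgn_eq_neg_one {t : Bits κ} (ht : t ≠ 0) : ∃ z : Bits κ, sgn z t = -1 := by
  obtain ⟨j, hj⟩ := Function.ne_iff.1 ht
  refine ⟨Pi.single j 1, ?_⟩
  have h1 : t j = 1 := (by decide : ∀ a : ZMod 2, a ≠ 0 → a = 1) _ hj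
  unfold sgn
  rw [Finset.prod_eq_single j]
  · simp [h1, ZMod.val_one]
  · intro i _ hi
    simp [Pi.single_eq_of_ne hi]
  · simp

theorem bits_add_eq_zero_iff (s t : Bits κ) : s + t = 0 ↔ s = t := by
  rw [eq_comm, bits_eq_add_iff, zero_add, eq_comm]

theorem sum_sgn (t : Bits κ) :
    ∑ z : Bits κ, sgn z t = if t = 0 then (2 : ℂ) ^ Fintype.card κ else 0 := by
  split_ifs with h
  · simp [h, sgn_zero_right]
  · obtain ⟨w, hw⟩ := exists_sgn_eq_neg_one h
    -- Translating by `w` negates every term, so the sum equals its own negative.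
    have h1 := Equiv.sum_comp (Equiv.addLeft w) fun z => sgn z t
    simp only [Equiv.coe_addLeft, sgn_add_left, hw, ← Finset.mul_sum] at h1
    linear_combination (-1 / 2 : ℂ) * h1

/-- The Pauli strings form a unitary 1-design. -/
theorem sum_pauliString_conj (B : Matrix (Bits κ) (Bits κ) ℂ) :
    ∑ p : Bits κ × Bits κ, pauliString p.1 p.2 * B * (pauliString p.1 p.2).conjTranspose
      = ((2 : ℂ) ^ Fintype.card κ * B.trace) • 1 := by
  ext s t
  -- Summing the sign over `z` kills the off-diagonal entries; summing the shift over `x` turns each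
  -- diagonal entry into the trace.
  have key (x z : Bits κ) : (pauliString x z * B * (pauliString x z).conjTranspose) s t
      = B (s + x) (t + x) * sgn z (s + t) := by
    have h : sgn z x * sgn z x = 1 := sgn_sq z x
    simp only [Matrix.mul_apply, pauliString_apply, Matrix.conjTranspose_apply, ite_mul, zero_mul,
      bits_eq_add_iff s _ x, bits_eq_add_iff t _ x, Finset.sum_ite_eq', Finset.mem_univ, if_true,
      apply_ite star, star_zero, mul_ite, mul_zero, star_sgn, sgn_add_right]
    linear_combination (sgn z s * B (s + x) (t + x) * sgn z t) * h
  rw [Matrix.sum_apply, Fintype.sum_prod_type]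
  simp only [key, ← Finset.mul_sum, sum_sgn]
  simp only [bits_add_eq_zero_iff, Matrix.smul_apply, Matrix.one_apply, smul_eq_mul]
  by_cases h : s = t
  · subst h
    have h1 : ∑ x, B (s + x) (s + x) = B.trace :=
      Equiv.sum_comp (Equiv.addLeft s) fun x => B x x
    rw [← Finset.sum_mul, if_pos rfl, if_pos rfl, h1, mul_one, mul_comm]
  · simp [h]

/-- Averaging over the `Z`-type Pauli strings removes the off-diagonal entries. -/
theorem sum_pauliString_zero_conj (B : Matrix (Bits κ) (Bits κ) ℂ) :
    ∑ z : Bits κ, pauliString 0 z * B * (pauliString 0 z).conjTranspose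
      = (2 : ℂ) ^ Fintype.card κ • ∑ b, B b b • Matrix.single b b (1 : ℂ) := by
  ext s t
  have key (z : Bits κ) : (pauliString 0 z * B * (pauliString 0 z).conjTranspose) s t
      = B s t * sgn z (s + t) := by
    simp only [Matrix.mul_apply, pauliString_apply, Matrix.conjTranspose_apply, ite_mul, zero_mul,
      add_zero, Finset.sum_ite_eq, Finset.mem_univ, if_true,
      apply_ite star, star_zero, mul_ite, mul_zero, star_sgn, sgn_add_right]
    ring
  rw [Matrix.sum_apply]
  simp only [key, ← Finset.mul_sum, sum_sgn, bits_add_eq_zero_iff, Matrix.smul_apply, Matrix.sum_apply,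
    Matrix.single_apply, smul_eq_mul]
  by_cases h : s = t
  · subst h; simp [mul_comm]
  · rw [Finset.sum_eq_zero]
    · simp [h]
    · rintro b -
      rw [if_neg (by rintro ⟨rfl, rfl⟩; exact h rfl), mul_zero]

/-- The sign by which the Pauli strings `p` and `q` commute. -/
noncomputable def commSign (p q : Bits κ × Bits κ) : ℂ := sgn p.2 q.1 * sgn q.2 p.1

theorem commSign_comm (p q : Bits κ × Bits κ) : commSign p q = commSign q p := mul_comm _ _

theorem commSign_add_right (p q r : Bits κ × Bits κ) :
    commSign p (q + r) = commSign p q * commSign p r := by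
  simp only [commSign, Prod.fst_add, Prod.snd_add, sgn_add_left, sgn_add_right]
  ring

theorem commSign_self (p : Bits κ × Bits κ) : commSign p p = 1 := sgn_sq _ _

theorem commSign_eq (p q : Bits κ × Bits κ) : commSign p q = 1 ∨ commSign p q = -1 := by
  unfold commSign
  rcases sgn_eq p.2 q.1 with h | h <;> rcases sgn_eq q.2 p.1 with h' | h' <;> simp [h, h']

theorem exists_commSign_eq_neg_one {p : Bits κ × Bits κ} (hp : p ≠ 0) :
    ∃ q, commSign p q = -1 := by
  by_cases h : p.1 = 0
  · have h2 : p.2 ≠ 0 := fun h2 => hp (Prod.ext h h2)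
    obtain ⟨w, hw⟩ := exists_sgn_eq_neg_one h2
    exact ⟨(w, 0), by simp [commSign, sgn_comm p.2 w, hw, sgn_zero_left]⟩
  · obtain ⟨w, hw⟩ := exists_sgn_eq_neg_one h
    exact ⟨(0, w), by simp [commSign, hw, sgn_zero_right]⟩

/-- The strings commuting with `p` and those commuting with `q` form two proper subgroups, and a
group is not the union of two proper subgroups. -/
theorem exists_commSign_eq_neg_one₂ {p q : Bits κ × Bits κ} (hp : p ≠ 0) (hq : q ≠ 0) :
    ∃ r, commSign p r = -1 ∧ commSign q r = -1 := by
  obtain ⟨a, ha⟩ := exists_commSign_eq_neg_one hp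
  obtain ⟨b, hb⟩ := exists_commSign_eq_neg_one hq
  rcases commSign_eq q a with h | h
  · rcases commSign_eq p b with h' | h'
    · exact ⟨a + b, by simp [commSign_add_right, ha, h'], by simp [commSign_add_right, hb, h]⟩
    · exact ⟨b, h', hb⟩
  · exact ⟨a, ha, h⟩

theorem pauliString_mul_comm (p q : Bits κ × Bits κ) :
    pauliString p.1 p.2 * pauliString q.1 q.2
      = commSign p q • (pauliString q.1 q.2 * pauliString p.1 p.2) := by
  rw [pauliString_mul, pauliString_mul, smul_smul, add_comm q.1, add_comm q.2, commSign,
    mul_assoc, sgn_sq, mul_one]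

/-- A multiple of each Pauli string is an anti-Hermitian unitary. -/
theorem exists_antiHermitian_pauli (p : Bits κ × Bits κ) :
    ∃ a : ℕ, star (Complex.I ^ a • pauliString p.1 p.2) = -(Complex.I ^ a • pauliString p.1 p.2) ∧
      (Complex.I ^ a • pauliString p.1 p.2) * (Complex.I ^ a • pauliString p.1 p.2) = -1 := by
  -- This sign tells whether the string is Hermitian or anti-Hermitian; only the Hermitian case
  -- needs a factor `i`.
  rcases sgn_eq p.2 p.1 with h | h
  · refine ⟨1, ?_, ?_⟩
    · rw [star_smul, pauliString_star, h]; simp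
    · rw [smul_mul_smul_comm, pauliString_mul, h, bits_add_self, bits_add_self, pauliString_zero]
      simp
  · refine ⟨0, ?_, ?_⟩
    · rw [star_smul, pauliString_star, h]; simp
    · rw [smul_mul_smul_comm, pauliString_mul, h, bits_add_self, bits_add_self, pauliString_zero]
      simp

/-- The Clifford unitary `(1 + K) / √2`, with `K` an anti-Hermitian multiple of the Pauli string
`r`, fixes the Pauli strings commuting with `r` and multiplies the others by `K`. -/
theorem exists_clifford_transvection (r : Bits κ × Bits κ) :
    ∃ (a : ℕ) (V : cliffordGroup κ), ∀ q : Bits κ × Bits κ,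
      (V.1.1 * pauliString q.1 q.2 * star V.1.1 : Matrix (Bits κ) (Bits κ) ℂ) =
        if commSign r q = 1 then pauliString q.1 q.2
        else (Complex.I ^ a • pauliString r.1 r.2) * pauliString q.1 q.2 := by
  obtain ⟨a, hK, hKK⟩ := exists_antiHermitian_pauli r
  set K := Complex.I ^ a • pauliString r.1 r.2 with hKdef
  set c : ℂ := (((Real.sqrt 2)⁻¹ : ℝ) : ℂ) with hc
  have hcc : c * c = 1 / 2 := by
    rw [hc, ← Complex.ofReal_mul, ← mul_inv, Real.mul_self_sqrt (by norm_num)]; norm_num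
  have hsc : star c = c := Complex.conj_ofReal _
  have hstar : star (c • (1 + K)) = c • (1 - K) := by
    rw [star_smul, star_add, hK, star_one, hsc, sub_eq_add_neg]
  have hU : c • (1 + K) ∈ Matrix.unitaryGroup (Bits κ) ℂ := by
    rw [Matrix.mem_unitaryGroup_iff, hstar, smul_mul_smul_comm, hcc]
    have : (1 + K) * (1 - K) = (2 : ℂ) • 1 := by
      rw [mul_sub, mul_one, add_mul, one_mul, hKK, two_smul]; abel
    rw [this, smul_smul]; norm_num
  have hconj (q : Bits κ × Bits κ) :
      c • (1 + K) * pauliString q.1 q.2 * star (c • (1 + K)) =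
        if commSign r q = 1 then pauliString q.1 q.2 else K * pauliString q.1 q.2 := by
    have hcomm : K * pauliString q.1 q.2 = commSign r q • (pauliString q.1 q.2 * K) := by
      rw [hKdef, smul_mul_assoc, pauliString_mul_comm, mul_smul_comm, smul_comm]
    set Q := pauliString q.1 q.2
    rw [hstar, smul_mul_assoc, smul_mul_smul_comm, hcc]
    -- Expand `(1 + K) Q (1 - K) = Q + K Q - Q K - K Q K`: two terms cancel and the other two
    -- coincide, in either case.
    rcases commSign_eq r q with h | h
    · rw [h, one_smul] at hcomm
      rw [if_pos h]
      have : (1 + K) * Q * (1 - K) = (2 : ℂ) • Q := by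
        have h3 : K * Q * K = -Q := by rw [hcomm, mul_assoc, hKK]; simp
        simp only [mul_sub, add_mul, one_mul, mul_one, h3]
        rw [hcomm, two_smul]; abel
      rw [this, smul_smul]; norm_num
    · have hn : ¬ commSign r q = 1 := by rw [h]; norm_num
      rw [h, neg_one_smul] at hcomm
      rw [if_neg hn]
      have : (1 + K) * Q * (1 - K) = (2 : ℂ) • (K * Q) := by
        have h3 : K * Q * K = Q := by rw [hcomm, neg_mul, mul_assoc, hKK]; simp
        have h4 : Q * K = - (K * Q) := by rw [hcomm, neg_neg]
        simp only [mul_sub, add_mul, one_mul, mul_one, h3]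
        rw [h4, two_smul]; abel
      rw [this, smul_smul]; norm_num
  let V : Matrix.unitaryGroup (Bits κ) ℂ := ⟨c • (1 + K), hU⟩
  have hV : V ∈ cliffordGroup κ := by
    have hKmem : K ∈ Matrix.unitaryGroup (Bits κ) ℂ := by
      rw [Matrix.mem_unitaryGroup_iff, hK, mul_neg, hKK, neg_neg]
    let KP : Matrix.unitaryGroup (Bits κ) ℂ := ⟨K, hKmem⟩
    have hKP : KP ∈ pauliGroup κ := ⟨a, r.1, r.2, hKdef⟩
    -- For a finite subgroup, mapping it into itself by conjugation already puts `V` in the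
    -- normalizer.
    have : Finite (pauliGroup κ : Set (Matrix.unitaryGroup (Bits κ) ℂ)) :=
      inferInstanceAs (Finite (pauliGroup κ))
    refine Subgroup.mem_normalizer_fintype fun Q hQ => ?_
    have hQ' := hQ
    obtain ⟨b, x, z, hQx⟩ := hQ'
    have h1 : (V * Q * V⁻¹).1 = Complex.I ^ b •
        if commSign r (x, z) = 1 then pauliString x z else K * pauliString x z := by
      rw [← hconj (x, z), ← smul_mul_assoc, ← mul_smul_comm, ← hQx]
      rfl
    by_cases h : commSign r (x, z) = 1
    · have : V * Q * V⁻¹ = Q := Subtype.ext (by rw [h1, if_pos h, hQx])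
      rwa [this]
    · have : V * Q * V⁻¹ = KP * Q := Subtype.ext (by
        rw [h1, if_neg h, ← mul_smul_comm, ← hQx]; rfl)
      rw [this]
      exact (pauliGroup κ).mul_mem hKP hQ
  exact ⟨a, ⟨V, hV⟩, hconj⟩

/-- The Clifford group acts transitively on the nontrivial Pauli strings up to phases. -/
theorem exists_clifford_conj_eq {p q : Bits κ × Bits κ} (hp : p ≠ 0) (hq : q ≠ 0) :
    ∃ (c : ℂ) (V : cliffordGroup κ),
      (V.1.1 * pauliString p.1 p.2 * star V.1.1 : Matrix (Bits κ) (Bits κ) ℂ) =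
        c • pauliString q.1 q.2 := by
  have step {p q : Bits κ × Bits κ} (h : commSign p q = -1) : ∃ (c : ℂ) (V : cliffordGroup κ),
      (V.1.1 * pauliString p.1 p.2 * star V.1.1 : Matrix (Bits κ) (Bits κ) ℂ) =
        c • pauliString q.1 q.2 := by
    -- The string `p + q` anticommutes with `p`, so this transvection takes `p` to a multiple of `(p
    -- + q) + p = q`.
    obtain ⟨a, V, hV⟩ := exists_clifford_transvection (p + q)
    have h1 : ¬ commSign (p + q) p = 1 := by
      rw [commSign_comm, commSign_add_right, commSign_self, h]; norm_num
    refine ⟨Complex.I ^ a * sgn (p + q).2 p.1, V, ?_⟩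
    rw [hV, if_neg h1, smul_mul_assoc, pauliString_mul, smul_smul, Prod.fst_add, Prod.snd_add,
      add_right_comm, bits_add_self, zero_add, add_right_comm, bits_add_self, zero_add]
  obtain ⟨r, hr, hr'⟩ := exists_commSign_eq_neg_one₂ hp hq
  obtain ⟨c, V, hV⟩ := step hr
  obtain ⟨d, W, hW⟩ := step ((commSign_comm r q).trans hr')
  refine ⟨c * d, W * V, ?_⟩
  have : ((W * V).1.1 * pauliString p.1 p.2 * star (W * V).1.1 : Matrix (Bits κ) (Bits κ) ℂ) =
      W.1.1 * (V.1.1 * pauliString p.1 p.2 * star V.1.1) * star W.1.1 := by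
    have h1 : (W * V).1.1 = W.1.1 * V.1.1 := rfl
    rw [h1, star_mul]; simp only [mul_assoc]
  rw [this, hV, mul_smul_comm, smul_mul_assoc, hW, smul_smul]

end Pauli

/-! ### Averages over the Clifford group and the measurement channel -/

section CliffordAverage

variable {κ : Type} [Fintype κ] [DecidableEq κ]

/-- The conjugation of `A` by the Heisenberg evolution `Uᴴ P U` of `P`. -/
noncomputable def evolvedConj (U P A : Matrix (Bits κ) (Bits κ) ℂ) : Matrix (Bits κ) (Bits κ) ℂ :=
  (U.conjTranspose * P * U) * A * (U.conjTranspose * P * U).conjTranspose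

/-- In this form `P` acts directly on `U A Uᴴ`, so sums over `P` become Pauli twirls. -/
theorem evolvedConj_eq (U P A : Matrix (Bits κ) (Bits κ) ℂ) :
    evolvedConj U P A =
      U.conjTranspose * (P * (U * A * U.conjTranspose) * P.conjTranspose) * U := by
  simp only [evolvedConj, Matrix.conjTranspose_mul, Matrix.conjTranspose_conjTranspose,
    Matrix.mul_assoc]

theorem evolvedConj_phase (c : ℂ) (hc : c * star c = 1) (U P A : Matrix (Bits κ) (Bits κ) ℂ) :
    evolvedConj (c • U) P A = evolvedConj U P A := by
  have h : (c • U).conjTranspose * P * (c • U) = U.conjTranspose * P * U := by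
    rw [Matrix.conjTranspose_smul, Matrix.mul_smul, Matrix.smul_mul, Matrix.smul_mul, smul_smul,
      hc, one_smul]
  rw [evolvedConj, h, evolvedConj]

theorem evolvedConj_phase_middle (c : ℂ) (hc : c * star c = 1)
    (U P A : Matrix (Bits κ) (Bits κ) ℂ) :
    evolvedConj U (c • P) A = evolvedConj U P A := by
  rw [evolvedConj_eq, evolvedConj_eq, Matrix.conjTranspose_smul, Matrix.mul_smul, Matrix.smul_mul,
    Matrix.smul_mul, smul_smul, mul_comm, hc, one_smul]

theorem mul_star_eq_one_of_smul_mem_unitary {c : ℂ} {P : Matrix (Bits κ) (Bits κ) ℂ}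
    (hP : P ∈ Matrix.unitaryGroup (Bits κ) ℂ) (hc : c • P ∈ Matrix.unitaryGroup (Bits κ) ℂ) :
    c * star c = 1 := by
  rw [Matrix.mem_unitaryGroup_iff] at hP hc
  rw [star_smul, smul_mul_smul_comm, hP] at hc
  simpa using congrFun (congrFun hc 0) 0

/-- Chosen representatives need not be multiplicative, but the defect is a global phase, which
`evolvedConj` does not see. -/
theorem Cl.exists_unitary_mk_mul (V : cliffordGroup κ) (g : Cl κ) :
    ∃ c : ℂ, c * star c = 1 ∧ Cl.unitary ((V : Cl κ) * g) = c • (V.1.1 * g.unitary) := by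
  obtain ⟨⟨W, c, hW⟩, h⟩ := QuotientGroup.mk_out_eq_mul (globalPhases κ) (V * Quotient.out g)
  have h1 : ((V * Quotient.out g : cliffordGroup κ) : Cl κ) = (V : Cl κ) * g := by
    rw [QuotientGroup.mk_mul, QuotientGroup.out_eq']
  rw [h1] at h
  refine ⟨c, mul_star_eq_one_of_smul_mem_unitary (one_mem (Matrix.unitaryGroup (Bits κ) ℂ)) ?_, ?_⟩
  · rw [← hW]; exact W.1.2
  · have h2 : Cl.unitary ((V : Cl κ) * g) = (V.1.1 * g.unitary) * W.1.1 :=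
      congrArg (fun X : cliffordGroup κ => X.1.1) h
    rw [h2, hW, mul_smul_comm, mul_one]

/-- The sum over the Clifford group of the conjugations by the evolved Pauli string does not
depend on the nontrivial Pauli string. -/
theorem sum_evolvedConj_eq {p q : Bits κ × Bits κ} (hp : p ≠ 0) (hq : q ≠ 0)
    (A : Matrix (Bits κ) (Bits κ) ℂ) :
    ∑ g : Cl κ, evolvedConj g.unitary (pauliString p.1 p.2) A =
      ∑ g : Cl κ, evolvedConj g.unitary (pauliString q.1 q.2) A := by
  obtain ⟨d, V, hV⟩ := exists_clifford_conj_eq hp hq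
  -- Replacing `U` by `Vᴴ U` changes `Uᴴ P U` into `Uᴴ (V P Vᴴ) U`, where `V P Vᴴ` is a phase times
  -- the string `q`.
  rw [← Equiv.sum_comp (Equiv.mulLeft (V⁻¹ : Cl κ))]
  refine Finset.sum_congr rfl fun g _ => ?_
  obtain ⟨c, hc, hg⟩ := Cl.exists_unitary_mk_mul V⁻¹ g
  have h1 : (V⁻¹).1.1 = star V.1.1 := rfl
  have hd : d * star d = 1 := by
    refine mul_star_eq_one_of_smul_mem_unitary (pauliString_mem_unitary q.1 q.2) ?_
    rw [← hV]
    exact mul_mem (mul_mem V.1.2 (pauliString_mem_unitary p.1 p.2)) (Unitary.star_mem V.1.2)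
  rw [Equiv.coe_mulLeft, ← QuotientGroup.mk_inv, hg, evolvedConj_phase c hc,
    ← evolvedConj_phase_middle d hd g.unitary (pauliString q.1 q.2), ← hV, h1]
  simp only [evolvedConj, ← Matrix.star_eq_conjTranspose, star_mul, star_star, mul_assoc]

theorem sum_evolvedConj_pauliString {U : Matrix (Bits κ) (Bits κ) ℂ}
    (hU : U ∈ Matrix.unitaryGroup (Bits κ) ℂ) (A : Matrix (Bits κ) (Bits κ) ℂ) :
    ∑ p : Bits κ × Bits κ, evolvedConj U (pauliString p.1 p.2) A =
      ((2 : ℂ) ^ Fintype.card κ * A.trace) • 1 := by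
  have h : U.conjTranspose * U = 1 := Matrix.mem_unitaryGroup_iff'.1 hU
  simp only [evolvedConj_eq]
  rw [← Finset.sum_mul, ← Finset.mul_sum, sum_pauliString_conj, Matrix.mul_smul, mul_one,
    Matrix.smul_mul, h, Matrix.trace_mul_cycle, h, one_mul]

theorem evolvedConj_one {U : Matrix (Bits κ) (Bits κ) ℂ}
    (hU : U ∈ Matrix.unitaryGroup (Bits κ) ℂ) (A : Matrix (Bits κ) (Bits κ) ℂ) :
    evolvedConj U 1 A = A := by
  have h : U.conjTranspose * U = 1 := Matrix.mem_unitaryGroup_iff'.1 hU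
  simp [evolvedConj, h]

theorem card_bits : (Fintype.card (Bits κ) : ℂ) = 2 ^ Fintype.card κ := by
  simp [Bits, ZMod.card]

/-- The measurement channel of the Clifford group: a random Clifford followed by a computational
basis measurement depolarizes. -/
theorem clifford_measurement_channel [Nonempty κ] (A : Matrix (Bits κ) (Bits κ) ℂ) :
    ((2 : ℂ) ^ Fintype.card κ + 1) • ∑ g : Cl κ, ∑ b,
        (g.unitary * A * g.unitary.conjTranspose) b b •
          (g.unitary.conjTranspose * Matrix.single b b 1 * g.unitary) =
      (Fintype.card (Cl κ) : ℂ) • (A + A.trace • 1) := by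
  set D : ℂ := 2 ^ Fintype.card κ with hD
  have hD0 : D ≠ 0 := pow_ne_zero _ two_ne_zero
  set N : ℂ := (Fintype.card (Cl κ) : ℂ) with hN
  set G : Bits κ × Bits κ → Matrix (Bits κ) (Bits κ) ℂ := fun p =>
    ∑ g : Cl κ, evolvedConj g.unitary (pauliString p.1 p.2) A with hG
  have hG0 : G 0 = N • A := by
    simp only [hG, Prod.fst_zero, Prod.snd_zero, pauliString_zero,
      evolvedConj_one (Cl.unitary_mem _), Finset.sum_const, Finset.card_univ]
    rw [hN, Nat.cast_smul_eq_nsmul]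
  have hsum : ∑ p, G p = N • ((D * A.trace) • 1) := by
    simp only [hG]
    rw [Finset.sum_comm]
    simp only [sum_evolvedConj_pauliString (Cl.unitary_mem _), Finset.sum_const,
      Finset.card_univ]
    rw [hN, Nat.cast_smul_eq_nsmul]
  -- A reference nontrivial `Z`-string; it exists because `κ` is nonempty.
  let z₁ : Bits κ := fun _ => 1
  have hz₁ : ((0, z₁) : Bits κ × Bits κ) ≠ 0 := by
    intro h
    exact one_ne_zero (congrFun (congrArg Prod.snd h) (Classical.arbitrary κ))
  set G₁ := G (0, z₁)
  have hconst (p : Bits κ × Bits κ) (hp : p ≠ 0) : G p = G₁ := sum_evolvedConj_eq hp hz₁ A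
  have hall : ∑ p, G p = N • A + (D * D - 1) • G₁ := by
    rw [← Finset.add_sum_erase _ _ (Finset.mem_univ 0), hG0,
      Finset.sum_congr rfl fun p hp => hconst p (Finset.ne_of_mem_erase hp), Finset.sum_const,
      Finset.card_erase_of_mem (Finset.mem_univ _), Finset.card_univ,
      ← Nat.cast_smul_eq_nsmul ℂ, Nat.cast_pred Fintype.card_pos, Fintype.card_prod,
      Nat.cast_mul, card_bits]
  have hconstZ (z : Bits κ) (hz : z ∈ Finset.univ.erase 0) : G (0, z) = G₁ :=
    hconst (0, z) fun h => Finset.ne_of_mem_erase hz (congrArg Prod.snd h)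
  have hZ : ∑ z : Bits κ, G (0, z) = N • A + (D - 1) • G₁ := by
    rw [← Finset.add_sum_erase _ _ (Finset.mem_univ 0), show ((0, 0) : Bits κ × Bits κ) = 0 from rfl,
      hG0, Finset.sum_congr rfl hconstZ, Finset.sum_const,
      Finset.card_erase_of_mem (Finset.mem_univ _), Finset.card_univ,
      ← Nat.cast_smul_eq_nsmul ℂ, Nat.cast_pred Fintype.card_pos, card_bits]
  have hmeas : D • ∑ g : Cl κ, ∑ b,
        (g.unitary * A * g.unitary.conjTranspose) b b •
          (g.unitary.conjTranspose * Matrix.single b b 1 * g.unitary) = ∑ z, G (0, z) := by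
    simp only [hG]
    rw [Finset.sum_comm (f := fun (z : Bits κ) (g : Cl κ) =>
      evolvedConj g.unitary (pauliString 0 z) A), Finset.smul_sum]
    refine Finset.sum_congr rfl fun g _ => ?_
    simp only [evolvedConj_eq]
    rw [← Finset.sum_mul, ← Finset.mul_sum, sum_pauliString_zero_conj, Matrix.mul_smul,
      Matrix.smul_mul, Finset.mul_sum, Finset.sum_mul]
    simp only [Matrix.mul_smul, Matrix.smul_mul]
    rfl
  set S := ∑ g : Cl κ, ∑ b, (g.unitary * A * g.unitary.conjTranspose) b b •
          (g.unitary.conjTranspose * Matrix.single b b 1 * g.unitary)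
  -- The factor `D + 1` turns the coefficient `D - 1` of `G₁` into `D * D - 1`, the one in the full
  -- twirl, so `G₁` is eliminated without division.
  have h1 : D • ((D + 1) • S) = D • (N • (A + A.trace • 1)) := by
    have h2 : (D * D - 1) • G₁ = N • ((D * A.trace) • 1) - N • A := by
      rw [← hsum, hall]; abel
    have h3 : (D + 1) • (D • S) = (D + 1) • (N • A) + (D * D - 1) • G₁ := by
      rw [hmeas, hZ, smul_add, smul_smul _ _ G₁]; congr 2; ring
    rw [smul_comm, h3, h2]
    module
  exact smul_right_injective _ hD0 h1

/-- The classical shadow is an unbiased estimator of the state. -/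
theorem sum_cliffordShadow [Nonempty κ] (A : Matrix (Bits κ) (Bits κ) ℂ) :
    ∑ g : Cl κ, ∑ b, (g.unitary * A * g.unitary.conjTranspose) b b • cliffordShadow g.unitary b =
      (Fintype.card (Cl κ) : ℂ) • A := by
  have htr (g : Cl κ) : ∑ b, (g.unitary * A * g.unitary.conjTranspose) b b = A.trace := by
    have h : g.unitary.conjTranspose * g.unitary = 1 :=
      Matrix.mem_unitaryGroup_iff'.1 g.unitary_mem
    have h1 : (g.unitary * A * g.unitary.conjTranspose).trace = A.trace := by
      rw [Matrix.trace_mul_cycle, h, one_mul]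
    exact h1
  -- The outcome weights sum to `A.trace`, so the `- 1` in the shadow removes exactly the channel's
  -- trace term.
  have h := clifford_measurement_channel A
  simp only [cliffordShadow, smul_sub, Finset.sum_sub_distrib, ← Finset.sum_smul, htr]
  simp only [smul_comm _ ((2 : ℂ) ^ Fintype.card κ + 1), ← Finset.smul_sum]
  rw [h, Finset.sum_const, Finset.card_univ, smul_add, ← Nat.cast_smul_eq_nsmul ℂ, smul_eq_mul,
    mul_smul, add_sub_cancel_right]

end CliffordAverage

/-! ### Finite expectations of complex functions -/

section Expectation

/-- The expectation of a complex function on a finite probability space. -/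
noncomputable def expect {α : Type} [Fintype α] (p : PMF α) (f : α → ℂ) : ℂ := ∑ a, (p a).toReal • f a

/-- Values of `F` off the support carry weight zero, so `F` may be any total extension of the
conditional expectation. -/
theorem expect_bindOnSupport {α β : Type} [Fintype α] [Fintype β] (p : PMF α)
    (q : ∀ a ∈ p.support, PMF β) (f : β → ℂ) (F : α → ℂ)
    (h : ∀ a ha, expect (q a ha) f = F a) :
    expect (p.bindOnSupport q) f = expect p F := by
  have key (b : β) : ((p.bindOnSupport q) b).toReal =
      ∑ a, (p a).toReal * (if ha : p a = 0 then 0 else q a ha b : ENNReal).toReal := by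
    rw [PMF.bindOnSupport_apply, tsum_fintype, ENNReal.toReal_sum]
    · simp only [ENNReal.toReal_mul]
    · intro a _
      refine ENNReal.mul_ne_top (p.apply_ne_top a) ?_
      split_ifs
      · exact ENNReal.zero_ne_top
      · exact PMF.apply_ne_top _ _
  unfold expect
  simp only [key, Finset.sum_smul, mul_smul]
  rw [Finset.sum_comm]
  refine Finset.sum_congr rfl fun a _ => ?_
  by_cases ha : p a = 0
  · simp [ha]
  · simp only [dif_neg ha]
    rw [← Finset.smul_sum, ← h a ha]
    rfl

theorem expect_bind {α β : Type} [Fintype α] [Fintype β] (p : PMF α) (q : α → PMF β)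
    (f : β → ℂ) : expect (p.bind q) f = expect p fun a => expect (q a) f := by
  rw [← PMF.bindOnSupport_eq_bind]
  exact expect_bindOnSupport p _ f _ fun _ _ => rfl

theorem expect_pure {α : Type} [Fintype α] (a : α) (f : α → ℂ) : expect (PMF.pure a) f = f a := by
  classical
  unfold expect
  rw [Finset.sum_eq_single a]
  · simp
  · intro b _ hb
    simp [PMF.pure_apply, hb]
  · simp

theorem expect_map {α β : Type} [Fintype α] [Fintype β] (p : PMF α) (φ : α → β) (f : β → ℂ) :
    expect (p.map φ) f = expect p (f ∘ φ) := by
  rw [← PMF.bind_pure_comp, expect_bind]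
  simp only [Function.comp_apply, expect_pure]
  rfl

theorem expect_uniformOfFinset {α : Type} [Fintype α] (s : Finset α) (hs : s.Nonempty)
    (f : α → ℂ) :
    expect (PMF.uniformOfFinset s hs) f = (s.card : ℂ)⁻¹ * ∑ a ∈ s, f a := by
  classical
  unfold expect
  simp only [PMF.uniformOfFinset_apply, apply_ite ENNReal.toReal, ENNReal.toReal_zero, ite_smul,
    zero_smul, ENNReal.toReal_inv, ENNReal.toReal_natCast]
  rw [Finset.sum_ite_mem, Finset.univ_inter, ← Finset.smul_sum, Complex.real_smul]
  simp

end Expectation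

/-! ### Expectations in the protocol and the trace against `L` -/

section Protocol

variable {κ : Type} [Fintype κ] [DecidableEq κ]

/-- Positivity makes the diagonal entries real and nonnegative, so nothing is lost through
`ENNReal.ofReal` of the real part. -/
theorem expect_measure (ρ : QState κ) (f : Bits κ → ℂ) :
    expect ρ.measure f = ∑ b, ρ.mat b b * f b := by
  refine Finset.sum_congr rfl fun b _ => ?_
  have h := Complex.nonneg_iff.1 (ρ.posSemidef.diag_nonneg (i := b))
  have h1 : (((ρ.mat b b).re : ℝ) : ℂ) = ρ.mat b b := Complex.ext rfl h.2
  rw [QState.measure, PMF.ofFintype_apply, ENNReal.toReal_ofReal h.1, Complex.real_smul, h1]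

theorem expect_measureOutside (ρ : QState κ) (k : Finset κ) (f : Bits {j // j ∉ k} → ℂ) :
    expect (ρ.measureOutside k) f = ∑ z, (ρ.block k z).trace * f z := by
  refine Finset.sum_congr rfl fun z _ => ?_
  have h := Complex.nonneg_iff.1 (ρ.block_posSemidef k z).trace_nonneg
  have h1 : (((ρ.block k z).trace.re : ℝ) : ℂ) = (ρ.block k z).trace := Complex.ext rfl h.2
  rw [QState.measureOutside, PMF.ofFintype_apply, ENNReal.toReal_ofReal h.1, Complex.real_smul, h1]

/-- A random Clifford shadow of `ρ` estimates every observable without bias. -/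
theorem expect_shadow [Nonempty κ] (ρ : QState κ) (L : Matrix (Bits κ) (Bits κ) ℂ) :
    (expect (PMF.uniformOfFintype (Cl κ)) fun g =>
      expect (ρ.evolve g.unitary g.unitary_mem).measure fun b =>
        (L * cliffordShadow g.unitary b).trace) = (L * ρ.mat).trace := by
  have hN : (Fintype.card (Cl κ) : ℂ) ≠ 0 := Nat.cast_ne_zero.2 Fintype.card_ne_zero
  have h := congrArg (fun X => (L * X).trace) (sum_cliffordShadow ρ.mat)
  simp only [Finset.mul_sum, Matrix.trace_sum, Matrix.mul_smul, Matrix.trace_smul,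
    smul_eq_mul] at h
  rw [PMF.uniformOfFintype, expect_uniformOfFinset]
  simp only [expect_measure, QState.evolve]
  rw [h, Finset.card_univ, inv_mul_cancel_left₀ hN]

/-- The factor `|z⟩⟨z|` forces both the row and the column string to equal `z` outside `k`. -/
theorem trace_reindex_single_kronecker_mul (ρ : QState κ) (k : Finset κ) (z : Bits {j // j ∉ k})
    (L : Matrix (Bits {j // j ∈ k}) (Bits {j // j ∈ k}) ℂ) :
    (Matrix.reindex (joinBits k) (joinBits k) (Matrix.single z z 1 ⊗ₖ L) * ρ.mat).trace =
      (L * ρ.block k z).trace := by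
  simp only [Matrix.trace, Matrix.diag_apply, Matrix.mul_apply, Matrix.reindex_apply,
    Matrix.submatrix_apply, QState.block]
  rw [← Equiv.sum_comp (joinBits k), Fintype.sum_prod_type, Finset.sum_eq_single z]
  · refine Finset.sum_congr rfl fun l _ => ?_
    rw [← Equiv.sum_comp (joinBits k), Fintype.sum_prod_type, Finset.sum_eq_single z]
    · simp
    · intro w _ hw
      simp [hw.symm]
    · simp
  · intro w _ hw
    simp [hw.symm]
  · simp

theorem trace_shadowOp_mul {n : ℕ} (Ψ : Bits (Fin n) → ℂ) (m : ℕ) (ρ : QState (Fin n)) :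
    (shadowOp Ψ m * ρ.mat).trace =
      (n.choose m : ℂ)⁻¹ * ∑ k ∈ Finset.powersetCard m (Finset.univ : Finset (Fin n)),
        ∑ z, (localObs Ψ k z * ρ.block k z).trace := by
  simp only [shadowOp, Matrix.smul_mul, Finset.sum_mul, Matrix.trace_smul, Matrix.trace_sum,
    trace_reindex_single_kronecker_mul, smul_eq_mul]

noncomputable instance (n : ℕ) : Fintype (Transcript n) := Fintype.ofFinite _

end Protocol

end ShadowOverlap

theorem mainTheorem7 (n m : ℕ) (hm1 : 1 ≤ m) (hmn : m ≤ n)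
    (Ψ : ShadowOverlap.Bits (Fin n) → ℂ) (hΨ : ∑ s, ‖Ψ s‖ ^ 2 = 1)
    (ρ : ShadowOverlap.QState (Fin n)) :
    (ShadowOverlap.shadowOp Ψ m * ρ.mat).trace =
      ∫ t, ShadowOverlap.overlap Ψ t ∂(ShadowOverlap.protocol ρ m hmn).toMeasure := by
  open ShadowOverlap in
  rw [trace_shadowOp_mul, PMF.integral_eq_sum]
  change _ = expect (protocol ρ m hmn) (overlap Ψ)
  rw [protocol, expect_bind, expect_uniformOfFinset, Finset.card_powersetCard, Finset.card_univ,
    Fintype.card_fin]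
  congr 1
  refine Finset.sum_congr rfl fun k hk => ?_
  have hk1 : k.Nonempty := by
    rw [← Finset.card_pos, (Finset.mem_powersetCard.1 hk).2]; omega
  have : Nonempty {j // j ∈ k} := hk1.to_subtype
  -- With `0⁻¹ = 0` this formula also makes sense for outcomes of probability zero, where
  -- `postState` is unavailable.
  rw [expect_bindOnSupport (F := fun z =>
    (localObs Ψ k z * ((ρ.block k z).trace⁻¹ • ρ.block k z)).trace), expect_measureOutside]
  · refine Finset.sum_congr rfl fun z _ => ?_
    -- A positive semidefinite block of trace zero vanishes, so such outcomes contribute nothing to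
    -- `tr (L ρ)` either.
    by_cases h : (ρ.block k z).trace = 0
    · rw [(ρ.block_posSemidef k z).trace_eq_zero_iff.1 h]; simp
    · rw [Matrix.mul_smul, Matrix.trace_smul, smul_eq_mul, mul_inv_cancel_left₀ h]
  · intro z hz
    rw [expect_bind]
    refine Eq.trans ?_ (expect_shadow (ρ.postState k z hz) (localObs Ψ k z))
    exact congrArg (expect _) (funext fun g => expect_map _ _ _)
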